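/- Let $(E,d)$ be a complete separable metric space with $d\le 1$, equipped with its Borel $\sigma$-algebra $\mathcal B(E)$, and let $P$ be a Markov kernel on $E$. For a kernel $K$ and a function $f\ge 0$ write $Kf(u)=\int f(v)\,K(u,\mathrm dv)$, and let $K^n$ be the $n$-fold iterate of $K$ ($K^0$ being the identity kernel). Assume the following. (i) There are a coupling kernel $Q$ for $P$ (a Markov kernel on $E\times E$ such that, for all $x,y\in E$, $Q((x,y),\cdot)$ has marginals $P(x,\cdot)$ and $P(y,\cdot)$), a measurable set $\Delta\subseteq E\times E$, an integer $\ell\ge 1$ and $\epsilon>0$ such that $$Qd(x,y)\le d(x,y)\ \text{ for all } x,y\in E,\qquad Q^\ell d(x,y)\le (1-\epsilon)\,d(x,y)\ \text{ for all } (x,y)\in\Delta .$$ (ii) There are a measurable function $\mathcal V:E\times E\to[1,\infty)$ and a constant $0\le b<\infty$ such that $$Q\mathcal V(x,y)\le \mathcal V(x,y)-1+b\,\mathbf 1_\Delta(x,y)\ \text{ for all } x,y\in E,\qquad \sup_{(x,y)\in\Delta}Q^{\ell-1}\mathcal V(x,y)<\infty .$$ (iii) There are a function $\psi:[0,\infty)\to[0,\infty)$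 such that $v\mapsto\psi(v)/v$ is non-increasing on $(0,\infty)$ and $\lim_{v\to\infty}\psi(v)=\infty$, a point $x_0\in E$, and a sequence of non-negative integers $n_k\to\infty$ such that, with $\mathcal V_{x_0}=\mathcal V(x_0,\cdot)$, $$\sup_{k} P^{n_k}[\psi\circ\mathcal V_{x_0}](x_0)<\infty .$$ Then $P$ admits a unique invariant probability measure $\pi$, and there is a constant $C<\infty$ such that for all integers $n\ge 2$ and all $x,y\in E$, $$Q^n d(x,y)\le C\,\frac{\log n}{n}\,\mathcal V(x,y).$$ -/

import Mathlib

open MeasureTheory ProbabilityTheory Filter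
open scoped ENNReal NNReal

/-- `γ` is a coupling of `μ` and `ν`: its two marginals are `μ` and `ν`. -/
def IsCoupling {E : Type*} [MeasurableSpace E] (γ : Measure (E × E)) (μ ν : Measure E) : Prop :=
  γ.map Prod.fst = μ ∧ γ.map Prod.snd = ν

/-- `Q` is a coupling kernel for the Markov kernel `P`: it is a Markov kernel on `E × E` and
`Q((x, y), ·)` is a coupling of `P(x, ·)` and `P(y, ·)` for all `x, y`. -/
structure IsCouplingKernel {E : Type*} [MeasurableSpace E]
    (Q : Kernel (E × E) (E × E)) (P : Kernel E E) : Prop where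
  isMarkov : IsMarkovKernel Q
  isCoupling : ∀ x y : E, IsCoupling (Q (x, y)) (P x) (P y)

/-- The contraction condition for `Q`: `Q d ≤ d` everywhere, and
`Q^ℓ d ≤ (1 - ε) d` on `Δ`, where `d` is the distance of `E`. -/
structure ContractionCondition {E : Type*} [MetricSpace E] [MeasurableSpace E]
    (Q : Kernel (E × E) (E × E)) (Δ : Set (E × E)) (ℓ : ℕ) (ε : ℝ) : Prop where
  weak : ∀ x y : E, ∫ z, dist z.1 z.2 ∂(Q (x, y)) ≤ dist x y
  strict : ∀ x y : E, (x, y) ∈ Δ → ∫ z, dist z.1 z.2 ∂((Q ^ ℓ) (x, y)) ≤ (1 - ε) * dist x y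

/-- The drift condition: `Q 𝒱 ≤ 𝒱 - 1 + b 1_Δ` everywhere, and `sup_Δ Q^(ℓ-1) 𝒱 < ∞`.
It is used for `𝒱 ≥ 1` and `ℓ ≥ 1`, where both truncated subtractions are exact. -/
structure DriftCondition {E : Type*} [MeasurableSpace E]
    (Q : Kernel (E × E) (E × E)) (Δ : Set (E × E)) (ℓ : ℕ) (𝒱 : E × E → ℝ≥0) (b : ℝ≥0) :
    Prop where
  drift : ∀ p : E × E,
    ∫⁻ z, (𝒱 z : ℝ≥0∞) ∂(Q p) ≤ (𝒱 p : ℝ≥0∞) - 1 + Δ.indicator (fun _ => (b : ℝ≥0∞)) p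
  bounded : ⨆ p ∈ Δ, ∫⁻ z, (𝒱 z : ℝ≥0∞) ∂((Q ^ (ℓ - 1)) p) < ∞

/-! ### Decay of the iterates of a kernel under drift and contraction -/

open scoped Topology

/-! The rate rests on one inequality, `natCast_mul_lintegral_pow_le`: for every k, n Q^n f ≤ n r^k f
+ V + k(ℓ + M), applied to f = d, with r the contraction factor and M a bound for Q^ℓ V on Δ.
Outside Δ, one step of Q lowers V by 1 on average, which pays for passing from n to n + 1. On Δ, ℓ
steps gain a factor r and use up one unit of k, at cost ℓ + M. Taking k of order log n gives the
rate log n / n.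

For the invariant measure, a coupling bounds differences of integrals of Lipschitz functions, so
P^m(x₀) and P^(m+j)(x₀) differ by at most ∫ Q^m d(x₀, y) P^j(x₀, dy) per unit of Lipschitz constant.
For fixed j this tends to 0 as m → ∞ by dominated convergence; for a suitable m it is small
uniformly over j = n_k, by the ψ-moment bound (`exists_forall_integral_integral_dist_pow_le`).
Comparing through P^(n_k+m)(x₀), the laws P^(n_k)(x₀) are eventually within δ of the single law
P^m(x₀), hence tight. A weak limit point is invariant because P preserves Lipschitz functions and
P^(n_k)(x₀), P^(n_k+1)(x₀) merge. Uniqueness follows by running Q from the product of two invariant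
measures. -/

instance Kernel.isMarkovKernel_pow {α : Type*} [MeasurableSpace α] (κ : Kernel α α)
    [IsMarkovKernel κ] (n : ℕ) : IsMarkovKernel (κ ^ n) := by
  induction n with
  | zero => exact inferInstanceAs (IsMarkovKernel (Kernel.id : Kernel α α))
  | succ n ih => rw [Kernel.pow_add]; simp only [pow_one]; infer_instance

theorem Kernel.lintegral_pow_add {α : Type*} [MeasurableSpace α] (κ : Kernel α α) (m n : ℕ)
    (a : α) {f : α → ℝ≥0∞} (hf : Measurable f) :
    ∫⁻ z, f z ∂(κ ^ (m + n)) a = ∫⁻ y, ∫⁻ z, f z ∂(κ ^ n) y ∂(κ ^ m) a := by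
  rw [add_comm, Kernel.pow_add, Kernel.lintegral_comp _ _ _ hf]

theorem Kernel.lintegral_pow_zero {α : Type*} [MeasurableSpace α] (κ : Kernel α α)
    (a : α) {f : α → ℝ≥0∞} (hf : Measurable f) :
    ∫⁻ z, f z ∂(κ ^ 0) a = f a := by
  rw [pow_zero]
  exact (congrArg (fun μ => ∫⁻ z, f z ∂μ) (Kernel.id_apply a)).trans (lintegral_dirac' a hf)

/-- Quantitative decay of `Q ^ n f` for a function `f ≤ 1` which is non-increasing under `Q`,
contracted by a factor `r` after `ℓ` steps from `Δ`, under a drift condition towards `Δ`. -/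
theorem natCast_mul_lintegral_pow_le {α : Type*} [MeasurableSpace α] (Q : Kernel α α)
    [IsMarkovKernel Q] {f : α → ℝ≥0∞} (hf : Measurable f) (hf_one : ∀ p, f p ≤ 1)
    (hf_weak : ∀ p, ∫⁻ z, f z ∂Q p ≤ f p)
    {Δ : Set α} {ℓ : ℕ} {r : ℝ≥0∞}
    (hf_strict : ∀ p ∈ Δ, ∫⁻ z, f z ∂(Q ^ ℓ) p ≤ r * f p)
    {V : α → ℝ≥0∞} (hV : Measurable V) (hV_drift : ∀ p ∉ Δ, ∫⁻ z, V z ∂Q p + 1 ≤ V p)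
    {M : ℝ≥0∞} (hV_bdd : ∀ p ∈ Δ, ∫⁻ z, V z ∂(Q ^ ℓ) p ≤ M) (k n : ℕ) (p : α) :
    n * ∫⁻ z, f z ∂(Q ^ n) p ≤ n * r ^ k * f p + V p + k * (ℓ + M) := by
  have hle : ∀ n p, ∫⁻ z, f z ∂(Q ^ n) p ≤ 1 := fun n p =>
    (lintegral_mono hf_one).trans (by simp)
  induction k generalizing n p with
  | zero =>
    have hmono : ∀ n p, ∫⁻ z, f z ∂(Q ^ n) p ≤ f p := by
      intro n
      induction n with
      | zero => intro p; rw [Kernel.lintegral_pow_zero _ _ hf]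
      | succ n ih =>
        intro p
        rw [add_comm, Kernel.lintegral_pow_add _ _ _ _ hf, pow_one]
        exact (lintegral_mono ih).trans (hf_weak p)
    calc (n : ℝ≥0∞) * ∫⁻ z, f z ∂(Q ^ n) p ≤ n * f p := by gcongr; exact hmono n p
      _ ≤ n * r ^ 0 * f p + V p + (0 : ℕ) * (ℓ + M) := by
        rw [pow_zero, mul_one, add_assoc]; exact le_self_add
  | succ k ihk =>
    -- The weight j + m is split: the part j is bounded using f ≤ 1, and only the weight m is kept
    -- after the first j steps.
    have step : ∀ (j m : ℕ) (q : α), ((j + m : ℕ) : ℝ≥0∞) * ∫⁻ z, f z ∂(Q ^ (j + m)) q ≤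
        j + ∫⁻ y, m * ∫⁻ z, f z ∂(Q ^ m) y ∂(Q ^ j) q := by
      intro j m q
      rw [lintegral_const_mul' _ _ (ENNReal.natCast_ne_top m),
        ← Kernel.lintegral_pow_add _ _ _ _ hf, Nat.cast_add, add_mul]
      gcongr
      exact (mul_le_of_le_one_right' (hle _ _))
    have int_bound : ∀ (j m : ℕ) (c : ℝ≥0∞) (e : ℝ≥0∞) (q : α),
        ∫⁻ y, (m * c * f y + V y + e) ∂(Q ^ j) q =
          m * c * ∫⁻ y, f y ∂(Q ^ j) q + ∫⁻ y, V y ∂(Q ^ j) q + e := by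
      intro j m c e q
      rw [lintegral_add_right _ measurable_const, lintegral_add_right _ hV,
        lintegral_const_mul _ hf]
      simp
    induction n generalizing p with
    | zero => simp
    | succ n ihn =>
      by_cases hp : p ∈ Δ
      -- If n + 1 < ℓ there is no room for the ℓ contracting steps, but the cost term already
      -- exceeds n + 1. Otherwise ℓ steps are run and the hypothesis for k is applied at the
      -- endpoint.
      · rcases lt_or_ge (n + 1) ℓ with hn | hn
        · calc ((n + 1 : ℕ) : ℝ≥0∞) * ∫⁻ z, f z ∂(Q ^ (n + 1)) p ≤ (n + 1 : ℕ) :=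
              mul_le_of_le_one_right' (hle _ _)
            _ ≤ ℓ := by exact_mod_cast hn.le
            _ ≤ ((k + 1 : ℕ) : ℝ≥0∞) * (ℓ + M) := by
              rw [Nat.cast_succ, add_mul, one_mul]
              exact le_self_add.trans le_add_self
            _ ≤ _ := le_add_self
        · obtain ⟨m, hm⟩ := Nat.exists_eq_add_of_le hn
          rw [hm]
          calc ((ℓ + m : ℕ) : ℝ≥0∞) * ∫⁻ z, f z ∂(Q ^ (ℓ + m)) p
              ≤ ℓ + ∫⁻ y, (m * r ^ k * f y + V y + k * (ℓ + M)) ∂(Q ^ ℓ) p := by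
                refine (step ℓ m p).trans ?_
                gcongr with y
                exact ihk m y
            _ ≤ ℓ + (m * r ^ k * (r * f p) + M + k * (ℓ + M)) := by
                rw [int_bound]
                gcongr
                · exact hf_strict p hp
                · exact hV_bdd p hp
            _ = m * r ^ (k + 1) * f p + ((k + 1 : ℕ) : ℝ≥0∞) * (ℓ + M) := by
                push_cast; ring
            _ ≤ _ := by
                gcongr
                refine le_trans ?_ le_self_add
                gcongr
                simp
      -- Outside Δ only n decreases and k is kept: the 1 produced by `step` is absorbed by the
      -- drift.
      · rw [add_comm n 1]
        calc ((1 + n : ℕ) : ℝ≥0∞) * ∫⁻ z, f z ∂(Q ^ (1 + n)) p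
            ≤ (1 : ℕ) + ∫⁻ y, (n * r ^ (k + 1) * f y + V y + (k + 1 : ℕ) * (ℓ + M)) ∂(Q ^ 1) p := by
              refine (step 1 n p).trans ?_
              gcongr with y
              exact ihn y
          _ = n * r ^ (k + 1) * ∫⁻ y, f y ∂Q p + (∫⁻ y, V y ∂Q p + 1)
              + (k + 1 : ℕ) * (ℓ + M) := by
              rw [int_bound, pow_one, Nat.cast_one]; ring
          _ ≤ (1 + n : ℕ) * r ^ (k + 1) * f p + V p + (k + 1 : ℕ) * (ℓ + M) := by
              gcongr
              · simp
              · exact hf_weak p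
              · exact hV_drift p hp

theorem integral_dist_nonneg {E : Type*} [MetricSpace E] [MeasurableSpace E]
    (μ : Measure (E × E)) : 0 ≤ ∫ z, dist z.1 z.2 ∂μ :=
  integral_nonneg fun _ => dist_nonneg

/-- The supremum is assumed after ℓ - 1 steps while the induction needs ℓ of them; one extra step
raises the mean of 𝒱 by at most b. -/
theorem DriftCondition.lintegral_pow_le {E : Type*} [MeasurableSpace E]
    {Q : Kernel (E × E) (E × E)} [IsMarkovKernel Q]
    {Δ : Set (E × E)} {ℓ : ℕ} (hℓ : 1 ≤ ℓ) {𝒱 : E × E → ℝ≥0} (h𝒱 : Measurable 𝒱)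
    {b : ℝ≥0} (hdrift : DriftCondition Q Δ ℓ 𝒱 b) {p : E × E} (hp : p ∈ Δ) :
    ∫⁻ z, (𝒱 z : ℝ≥0∞) ∂(Q ^ ℓ) p ≤
      (⨆ p ∈ Δ, ∫⁻ z, (𝒱 z : ℝ≥0∞) ∂((Q ^ (ℓ - 1)) p)) + b := by
  have h𝒱' : Measurable fun z => (𝒱 z : ℝ≥0∞) := h𝒱.coe_nnreal_ennreal
  have hstep : ∀ q, ∫⁻ z, (𝒱 z : ℝ≥0∞) ∂Q q ≤ 𝒱 q + b := fun q => by
    refine (hdrift.drift q).trans ?_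
    gcongr
    · exact tsub_le_self
    · exact Set.indicator_le_self' (fun _ _ => zero_le) q
  calc ∫⁻ z, (𝒱 z : ℝ≥0∞) ∂(Q ^ ℓ) p
      = ∫⁻ y, ∫⁻ z, (𝒱 z : ℝ≥0∞) ∂Q y ∂(Q ^ (ℓ - 1)) p := by
        conv_lhs => rw [← Nat.sub_add_cancel hℓ]
        rw [Kernel.lintegral_pow_add _ _ _ _ h𝒱', pow_one]
    _ ≤ ∫⁻ y, ((𝒱 y : ℝ≥0∞) + b) ∂(Q ^ (ℓ - 1)) p := lintegral_mono hstep
    _ = ∫⁻ y, (𝒱 y : ℝ≥0∞) ∂(Q ^ (ℓ - 1)) p + b := by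
        rw [lintegral_add_right _ measurable_const]; simp
    _ ≤ _ := by
        gcongr
        exact le_iSup₂ (f := fun p (_ : p ∈ Δ) => ∫⁻ z, (𝒱 z : ℝ≥0∞) ∂((Q ^ (ℓ - 1)) p)) p hp

/-! ### The rate log n / n for the distance -/

section Distance

variable {E : Type*} [MetricSpace E] [SecondCountableTopology E] [MeasurableSpace E] [BorelSpace E]

theorem integrable_dist_of_dist_le_one (hd : ∀ x y : E, dist x y ≤ 1) (μ : Measure (E × E))
    [IsFiniteMeasure μ] : Integrable (fun z => dist z.1 z.2) μ :=
  Integrable.of_bound (measurable_dist.aestronglyMeasurable) 1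
    (ae_of_all _ fun z => by simpa [abs_of_nonneg dist_nonneg] using hd z.1 z.2)

theorem ofReal_integral_dist (hd : ∀ x y : E, dist x y ≤ 1) (μ : Measure (E × E))
    [IsFiniteMeasure μ] :
    ENNReal.ofReal (∫ z, dist z.1 z.2 ∂μ) = ∫⁻ z, edist z.1 z.2 ∂μ := by
  rw [ofReal_integral_eq_lintegral_ofReal (integrable_dist_of_dist_le_one hd μ)
    (ae_of_all _ fun z => dist_nonneg)]
  simp_rw [edist_dist]

theorem integral_dist_le_one (hd : ∀ x y : E, dist x y ≤ 1) (μ : Measure (E × E))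
    [IsProbabilityMeasure μ] : ∫ z, dist z.1 z.2 ∂μ ≤ 1 := by
  calc ∫ z, dist z.1 z.2 ∂μ ≤ ∫ _, (1 : ℝ) ∂μ :=
        integral_mono (integrable_dist_of_dist_le_one hd μ) (integrable_const _)
          fun z => hd z.1 z.2
    _ = 1 := by simp

/-- The factor r is any nonnegative majorant of 1 - ε, since 1 - ε itself may be negative. -/
theorem exists_mul_integral_dist_pow_le (hd : ∀ x y : E, dist x y ≤ 1)
    {Q : Kernel (E × E) (E × E)} [IsMarkovKernel Q] {Δ : Set (E × E)} {ℓ : ℕ} (hℓ : 1 ≤ ℓ)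
    {ε : ℝ} (hcontr : ContractionCondition Q Δ ℓ ε)
    {𝒱 : E × E → ℝ≥0} (h𝒱 : Measurable 𝒱) (h𝒱_one : ∀ p, 1 ≤ 𝒱 p) {b : ℝ≥0}
    (hdrift : DriftCondition Q Δ ℓ 𝒱 b) {r : ℝ} (hr : 0 ≤ r) (hεr : 1 - ε ≤ r) :
    ∃ B : ℝ, 0 ≤ B ∧ ∀ (k n : ℕ) (x y : E),
      n * ∫ z, dist z.1 z.2 ∂((Q ^ n) (x, y)) ≤ n * r ^ k + 𝒱 (x, y) + k * B := by
  set M := (⨆ p ∈ Δ, ∫⁻ z, (𝒱 z : ℝ≥0∞) ∂((Q ^ (ℓ - 1)) p)) + b with hM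
  have hM_top : M ≠ ∞ := ENNReal.add_ne_top.2 ⟨hdrift.bounded.ne, ENNReal.coe_ne_top⟩
  refine ⟨ℓ + M.toReal, by positivity, fun k n x y => ?_⟩
  have hdec := natCast_mul_lintegral_pow_le Q (f := fun z => edist z.1 z.2) measurable_edist
    (fun z => by rw [edist_dist]; exact ENNReal.ofReal_le_one.2 (hd _ _))
    (fun z => by
      rw [← ofReal_integral_dist hd, edist_dist]
      exact ENNReal.ofReal_le_ofReal (hcontr.weak z.1 z.2))
    (Δ := Δ) (ℓ := ℓ) (r := ENNReal.ofReal r)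
    (fun z hz => by
      rw [← ofReal_integral_dist hd, edist_dist, ← ENNReal.ofReal_mul hr]
      exact ENNReal.ofReal_le_ofReal
        ((hcontr.strict z.1 z.2 hz).trans (mul_le_mul_of_nonneg_right hεr dist_nonneg)))
    (V := fun z => (𝒱 z : ℝ≥0∞)) h𝒱.coe_nnreal_ennreal
    (fun z hz => by
      have h := hdrift.drift z
      rw [Set.indicator_of_notMem hz, add_zero] at h
      have h1 : (1 : ℝ≥0∞) ≤ 𝒱 z := by exact_mod_cast h𝒱_one z
      calc _ ≤ ((𝒱 z : ℝ≥0∞) - 1) + 1 := by gcongr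
        _ = 𝒱 z := tsub_add_cancel_of_le h1)
    (M := M) (fun z hz => hdrift.lintegral_pow_le hℓ h𝒱 hz) k n (x, y)
  rw [← ofReal_integral_dist hd] at hdec
  have hone : edist x y ≤ 1 := by rw [edist_dist]; exact ENNReal.ofReal_le_one.2 (hd _ _)
  have hdec' : ENNReal.ofReal (n * ∫ z, dist z.1 z.2 ∂((Q ^ n) (x, y))) ≤
      ENNReal.ofReal (n * r ^ k + 𝒱 (x, y) + k * (ℓ + M.toReal)) := by
    rw [ENNReal.ofReal_add (by positivity) (by positivity),
      ENNReal.ofReal_add (by positivity) (by positivity), ENNReal.ofReal_mul (by positivity),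
      ENNReal.ofReal_mul (by positivity), ENNReal.ofReal_mul (by positivity),
      ENNReal.ofReal_add (by positivity) (by positivity), ENNReal.ofReal_toReal hM_top,
      ENNReal.ofReal_pow hr]
    simp only [ENNReal.ofReal_natCast, ENNReal.ofReal_coe_nnreal]
    refine hdec.trans ?_
    gcongr ?_ + _ + _
    exact mul_le_of_le_one_right' hone
  exact (ENNReal.ofReal_le_ofReal_iff (by positivity)).1 hdec'

theorem exists_integral_dist_pow_le (hd : ∀ x y : E, dist x y ≤ 1)
    {Q : Kernel (E × E) (E × E)} [IsMarkovKernel Q] {Δ : Set (E × E)} {ℓ : ℕ} (hℓ : 1 ≤ ℓ)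
    {ε : ℝ} (hε : 0 < ε) (hcontr : ContractionCondition Q Δ ℓ ε)
    {𝒱 : E × E → ℝ≥0} (h𝒱 : Measurable 𝒱) (h𝒱_one : ∀ p, 1 ≤ 𝒱 p) {b : ℝ≥0}
    (hdrift : DriftCondition Q Δ ℓ 𝒱 b) :
    ∃ C : ℝ, ∀ n : ℕ, 2 ≤ n → ∀ x y : E,
      ∫ z, dist z.1 z.2 ∂((Q ^ n) (x, y)) ≤ C * (Real.log n / n) * 𝒱 (x, y) := by
  -- The maximum with 1/2 ensures 0 < r even when ε ≥ 1, so that log r is a genuine negative number.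
  set r := max (1 - ε) (1 / 2) with hr_def
  have hr0 : 0 < r := lt_max_of_lt_right (by norm_num)
  have hr1 : r < 1 := max_lt (by linarith) (by norm_num)
  obtain ⟨B, hB, hbound⟩ := exists_mul_integral_dist_pow_le hd hℓ hcontr h𝒱 h𝒱_one hdrift
    hr0.le (le_max_left _ _)
  set lam := -Real.log r with hlam_def
  have hlam : 0 < lam := neg_pos.2 (Real.log_neg hr0 hr1)
  have hlog2 : 0 < Real.log 2 := Real.log_pos one_lt_two
  -- The bound to absorb is 1 + 𝒱 + (log n / lam + 1) B. Since 𝒱 ≥ 1, it is at most (2 + B + (B /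
  -- lam) log n) 𝒱, and log n ≥ log 2 turns 2 + B into a multiple of log n.
  refine ⟨(2 + B) / Real.log 2 + B / lam, fun n hn x y => ?_⟩
  have hn0 : (0 : ℝ) < n := by exact_mod_cast (by omega : 0 < n)
  have hlogn : Real.log 2 ≤ Real.log n := Real.log_le_log two_pos (by exact_mod_cast hn)
  have hV : (1 : ℝ) ≤ 𝒱 (x, y) := by exact_mod_cast h𝒱_one (x, y)
  -- The least k with n r^k ≤ 1.
  set k := ⌈Real.log n / lam⌉₊ with hk_def
  have hk_ge : Real.log n / lam ≤ k := Nat.le_ceil _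
  have hk_le : (k : ℝ) ≤ Real.log n / lam + 1 :=
    (Nat.ceil_lt_add_one (div_nonneg (by linarith) hlam.le)).le
  have hrk : n * r ^ k ≤ 1 := by
    rw [← Real.log_nonpos_iff (by positivity), Real.log_mul hn0.ne' (by positivity), Real.log_pow]
    rw [div_le_iff₀ hlam] at hk_ge
    have : (k : ℝ) * Real.log r = -(k * lam) := by rw [hlam_def]; ring
    linarith
  have hb := hbound k n x y
  have hkB : (k : ℝ) * B ≤ (Real.log n / lam + 1) * B := by gcongr
  have key : n * ∫ z, dist z.1 z.2 ∂((Q ^ n) (x, y)) ≤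
      ((2 + B) / Real.log 2 + B / lam) * Real.log n * 𝒱 (x, y) := by
    have h1 : 2 + B ≤ (2 + B) / Real.log 2 * Real.log n := by
      rw [div_mul_eq_mul_div, le_div_iff₀ hlog2]
      gcongr
    have h2 : (Real.log n / lam + 1) * B = B / lam * Real.log n + B := by ring
    have h3 : 0 ≤ B / lam * Real.log n := by
      have : 0 ≤ Real.log n := by linarith
      positivity
    calc n * ∫ z, dist z.1 z.2 ∂((Q ^ n) (x, y))
        ≤ 1 + 𝒱 (x, y) + (B / lam * Real.log n + B) := by linarith
      _ ≤ (2 + B + B / lam * Real.log n) * 𝒱 (x, y) := by nlinarith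
      _ ≤ _ := by
        gcongr
        rw [add_mul]
        linarith
  calc ∫ z, dist z.1 z.2 ∂((Q ^ n) (x, y))
      ≤ ((2 + B) / Real.log 2 + B / lam) * Real.log n * 𝒱 (x, y) / n := by
        rw [le_div_iff₀ hn0]; linarith
    _ = _ := by ring

end Distance

/-! ### Tightness from closeness on Lipschitz functions -/

/-- A sequence of measures is tight if, for all `η, ε > 0`, all of its terms are concentrated up to
mass `ε` on the `η`-thickening of a common compact set. -/
theorem isTightMeasureSet_range_of_cthickening {E ι : Type*} [MetricSpace E]
    [CompleteSpace E] [MeasurableSpace E] {ν : ι → Measure E}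
    (h : ∀ η : ℝ, 0 < η → ∀ ε : ℝ≥0, 0 < ε →
      ∃ K : Set E, IsCompact K ∧ ∀ k, ν k (Metric.cthickening η K)ᶜ ≤ ε) :
    IsTightMeasureSet (Set.range ν) := by
  rw [isTightMeasureSet_iff_exists_isCompact_measure_compl_le]
  intro ε hε
  obtain ⟨ε', hε'_pos, hε'_sum⟩ := ENNReal.exists_pos_sum_of_countable hε.ne' ℕ
  obtain ⟨u, -, hu_pos, hu⟩ := exists_seq_strictAnti_tendsto (0 : ℝ)
  choose K hK_comp hK using fun m => h (u m) (hu_pos m) (ε' m) (hε'_pos m)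
  -- The intersection is closed and totally bounded: once u m < δ/2, a finite δ/2-net of K m is a
  -- δ-net of it. Completeness then gives compactness.
  refine ⟨⋂ m, Metric.cthickening (u m) (K m), ?_, ?_⟩
  · refine TotallyBounded.isCompact_of_isClosed ?_
      (isClosed_iInter fun _ => Metric.isClosed_cthickening)
    refine Metric.totallyBounded_iff.2 fun δ hδ => ?_
    obtain ⟨m, hm⟩ := (hu.eventually_lt_const (half_pos hδ)).exists
    obtain ⟨t, ht_fin, ht⟩ := Metric.totallyBounded_iff.1 (hK_comp m).totallyBounded _ (half_pos hδ)
    refine ⟨t, ht_fin, fun x hx => ?_⟩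
    have hx' : x ∈ Metric.thickening (δ / 2) (K m) :=
      Metric.cthickening_subset_thickening' (half_pos hδ) hm _ (Set.mem_iInter.1 hx m)
    obtain ⟨y, hyK, hxy⟩ := Metric.mem_thickening_iff.1 hx'
    obtain ⟨z, hz, hyz⟩ := Set.mem_iUnion₂.1 (ht hyK)
    refine Set.mem_iUnion₂.2 ⟨z, hz, ?_⟩
    rw [Metric.mem_ball] at hyz ⊢
    linarith [dist_triangle x y z]
  · rintro _ ⟨k, rfl⟩
    rw [Set.compl_iInter]
    calc ν k (⋃ m, (Metric.cthickening (u m) (K m))ᶜ)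
        ≤ ∑' m, ν k (Metric.cthickening (u m) (K m))ᶜ := measure_iUnion_le _
      _ ≤ ∑' m, (ε' m : ℝ≥0∞) := ENNReal.tsum_le_tsum fun m => hK m k
      _ ≤ ε := hε'_sum.le

/-- If two probability measures are close when tested against Lipschitz functions, the mass that
one gives to a compact set is almost given by the other to a thickening of that set. -/
theorem measure_compl_cthickening_le {E : Type*} [MetricSpace E] [MeasurableSpace E]
    [BorelSpace E] {μ ν : Measure E} [IsProbabilityMeasure μ]
    [IsProbabilityMeasure ν] {η : ℝ} (hη : 0 < η) {ε : ℝ≥0} {δ : ℝ} (hδ : δ ≤ η * (ε / 2))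
    (hclose : ∀ (L : ℝ≥0) (f : E → ℝ), LipschitzWith L f → (∀ x, f x ∈ Set.Icc 0 1) →
      |∫ x, f x ∂ν - ∫ x, f x ∂μ| ≤ L * δ)
    {K : Set E} (hK : IsCompact K) (hμK : μ Kᶜ ≤ (ε / 2 : ℝ≥0)) :
    ν (Metric.cthickening η K)ᶜ ≤ ε := by
  -- The test function has Lipschitz constant 1/η, so closeness δ ≤ η ε/2 costs mass ε/2; the other
  -- ε/2 is the mass of μ outside K.
  obtain ⟨f, hf_lip, hf_mem, hf_one, hf_zero⟩ : ∃ f : E → ℝ, LipschitzWith η.toNNReal⁻¹ f ∧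
      (∀ x, f x ∈ Set.Icc 0 1) ∧ (∀ x ∈ K, f x = 1) ∧ ∀ x ∉ Metric.thickening η K, f x = 0 :=
    ⟨fun x => thickenedIndicator hη K x, lipschitzWith_thickenedIndicator hη K,
      fun x => ⟨NNReal.coe_nonneg _, NNReal.coe_le_one.2 (thickenedIndicator_le_one hη K x)⟩,
      fun x hx => by simp only [thickenedIndicator_one hη K hx, NNReal.coe_one],
      fun x hx => by simp only [thickenedIndicator_zero hη K hx, NNReal.coe_zero]⟩
  have hf_int : ∀ (ρ : Measure E) [IsProbabilityMeasure ρ], Integrable f ρ := fun ρ _ =>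
    Integrable.of_bound hf_lip.continuous.aestronglyMeasurable 1
      (ae_of_all _ fun x => by
        rw [Real.norm_eq_abs, abs_of_nonneg (hf_mem x).1]; exact (hf_mem x).2)
  have hclose' : |∫ x, f x ∂ν - ∫ x, f x ∂μ| ≤ ε / 2 := by
    refine (hclose _ f hf_lip hf_mem).trans ?_
    rw [NNReal.coe_inv, Real.coe_toNNReal _ hη.le, inv_mul_le_iff₀ hη]
    exact hδ
  have hμ : 1 - (ε / 2 : ℝ) ≤ ∫ x, f x ∂μ := by
    have h1 : μ.real Kᶜ ≤ ε / 2 := by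
      have := ENNReal.toReal_mono ENNReal.coe_ne_top hμK
      simpa [Measure.real] using this
    have h2 : μ.real K ≤ ∫ x, f x ∂μ := by
      rw [← integral_indicator_one hK.measurableSet]
      refine integral_mono ((integrable_const (1 : ℝ)).indicator hK.measurableSet) (hf_int μ) ?_
      intro x
      by_cases hx : x ∈ K
      · simp [hx, hf_one x hx]
      · simpa [hx] using (hf_mem x).1
    have h3 := probReal_compl_eq_one_sub (μ := μ) hK.measurableSet
    linarith
  have hν : ∫ x, f x ∂ν ≤ ν.real (Metric.cthickening η K) := by
    have hmeas : MeasurableSet (Metric.cthickening η K) := Metric.isClosed_cthickening.measurableSet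
    rw [← integral_indicator_one hmeas]
    refine integral_mono (hf_int ν) ((integrable_const (1 : ℝ)).indicator hmeas) ?_
    intro x
    by_cases hx : x ∈ Metric.cthickening η K
    · simpa [hx] using (hf_mem x).2
    · have : x ∉ Metric.thickening η K := fun h => hx (Metric.thickening_subset_cthickening _ _ h)
      simp [hx, hf_zero x this]
  have hcompl := probReal_compl_eq_one_sub (μ := ν)
    (Metric.isClosed_cthickening (δ := η) (E := K)).measurableSet
  have hfin : ν.real (Metric.cthickening η K)ᶜ ≤ ε := by
    have := (abs_le.1 hclose').1
    linarith
  rw [← ENNReal.ofReal_coe_nnreal]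
  exact (ENNReal.le_ofReal_iff_toReal_le (measure_ne_top _ _) ε.2).2 hfin

/-- Probability measures with the same integrals of bounded Lipschitz functions coincide. -/
theorem eq_of_forall_integral_lipschitz_eq {E : Type*} [MetricSpace E] [MeasurableSpace E]
    [BorelSpace E] {μ ν : Measure E} [IsProbabilityMeasure μ]
    [IsProbabilityMeasure ν]
    (h : ∀ (L : ℝ≥0) (f : E → ℝ), LipschitzWith L f → ∫ x, f x ∂μ = ∫ x, f x ∂ν) : μ = ν := by
  let μ' : ProbabilityMeasure E := ⟨μ, inferInstance⟩
  let ν' : ProbabilityMeasure E := ⟨ν, inferInstance⟩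
  have hlim : Tendsto (fun _ : ℕ => μ') atTop (𝓝 ν') := by
    rw [tendsto_iff_forall_lipschitz_integral_tendsto]
    rintro f - ⟨L, hf⟩
    have : ∫ x, f x ∂(μ' : Measure E) = ∫ x, f x ∂(ν' : Measure E) := h L f hf
    simp only [this]
    exact tendsto_const_nhds
  have heq : μ' = ν' := tendsto_nhds_unique tendsto_const_nhds hlim
  exact congrArg ProbabilityMeasure.toMeasure heq

section Tightness

variable {E : Type*} [MetricSpace E] [CompleteSpace E] [SecondCountableTopology E]
  [MeasurableSpace E] [BorelSpace E]

/-- A sequence of probability measures which is totally bounded for the distance given by testing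
against Lipschitz functions is tight. -/
theorem isTightMeasureSet_range_of_lipschitz_close {ν : ℕ → Measure E}
    [∀ k, IsProbabilityMeasure (ν k)]
    (h : ∀ δ : ℝ, 0 < δ → ∃ μ : Measure E, IsProbabilityMeasure μ ∧ ∀ᶠ k in atTop,
      ∀ (L : ℝ≥0) (f : E → ℝ), LipschitzWith L f → (∀ x, f x ∈ Set.Icc 0 1) →
        |∫ x, f x ∂ν k - ∫ x, f x ∂μ| ≤ L * δ) :
    IsTightMeasureSet (Set.range ν) := by
  have hsingle : ∀ (μ : Measure E) [IsProbabilityMeasure μ] (ε : ℝ≥0), 0 < ε →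
      ∃ K, IsCompact K ∧ μ Kᶜ ≤ ε := fun μ _ ε hε => by
    obtain ⟨K, hK, hμK⟩ := isTightMeasureSet_iff_exists_isCompact_measure_compl_le.1
      (isTightMeasureSet_singleton (μ := μ)) ε (by exact_mod_cast hε)
    exact ⟨K, hK, hμK μ rfl⟩
  refine isTightMeasureSet_range_of_cthickening fun η hη ε hε => ?_
  obtain ⟨μ, hμ, hclose⟩ := h (η * (ε / 2)) (by positivity)
  obtain ⟨N, hN⟩ := eventually_atTop.1 hclose
  obtain ⟨K₀, hK₀, hμK₀⟩ := hsingle μ (ε / 2) (by positivity)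
  -- The finitely many measures before N need not be close to μ; each contributes its own compact
  -- set.
  choose K hK hνK using fun k => hsingle (ν k) ε hε
  refine ⟨K₀ ∪ ⋃ k ∈ Set.Iio N, K k,
    hK₀.union ((Set.finite_Iio N).isCompact_biUnion fun k _ => hK k), fun k => ?_⟩
  rcases lt_or_ge k N with hk | hk
  · refine (measure_mono (Set.compl_subset_compl.2 ?_)).trans (hνK k)
    refine Set.Subset.trans ?_ (Metric.self_subset_cthickening _)
    exact Set.Subset.trans (Set.subset_biUnion_of_mem (u := K) (Set.mem_Iio.2 hk))
      Set.subset_union_right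
  · refine (measure_mono (Set.compl_subset_compl.2 ?_)).trans
      (measure_compl_cthickening_le hη le_rfl (hN k hk) hK₀ hμK₀)
    exact Metric.cthickening_subset_of_subset _ Set.subset_union_left

theorem exists_tendsto_subseq_of_lipschitz_close {ν : ℕ → ProbabilityMeasure E}
    (h : ∀ δ : ℝ, 0 < δ → ∃ μ : Measure E, IsProbabilityMeasure μ ∧ ∀ᶠ k in atTop,
      ∀ (L : ℝ≥0) (f : E → ℝ), LipschitzWith L f → (∀ x, f x ∈ Set.Icc 0 1) →
        |∫ x, f x ∂(ν k : Measure E) - ∫ x, f x ∂μ| ≤ L * δ) :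
    ∃ (π : ProbabilityMeasure E) (φ : ℕ → ℕ), StrictMono φ ∧
      Tendsto (fun k => ν (φ k)) atTop (𝓝 π) := by
  have htight := isTightMeasureSet_range_of_lipschitz_close (ν := fun k => (ν k : Measure E)) h
  have hcomp : IsCompact (closure (Set.range ν)) := by
    refine isCompact_closure_of_isTightMeasureSet (htight.subset ?_)
    rintro _ ⟨_, ⟨k, rfl⟩, rfl⟩
    exact ⟨k, rfl⟩
  obtain ⟨π, -, φ, hφ, hlim⟩ := hcomp.isSeqCompact fun k => subset_closure (Set.mem_range_self k)
  exact ⟨π, φ, hφ, hlim⟩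

end Tightness

/-! ### Coupling kernels and Lipschitz test functions -/

theorem map_pow_of_map_eq {α β : Type*} [MeasurableSpace α] [MeasurableSpace β]
    {Q : Kernel α α} {P : Kernel β β} {g : α → β} (hg : Measurable g)
    (h : ∀ a, (Q a).map g = P (g a)) (m : ℕ) (a : α) :
    ((Q ^ m) a).map g = (P ^ m) (g a) := by
  induction m generalizing a with
  | zero =>
    ext s hs
    rw [Measure.map_apply hg hs, pow_zero, pow_zero]
    change Kernel.id a (g ⁻¹' s) = Kernel.id (g a) s
    rw [Kernel.id_apply, Kernel.id_apply, Measure.dirac_apply' _ (hg hs), Measure.dirac_apply' _ hs]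
    rfl
  | succ m ih =>
    ext s hs
    rw [Measure.map_apply hg hs, add_comm, Kernel.pow_add_apply_eq_lintegral _ _ _ _ (hg hs),
      Kernel.pow_add_apply_eq_lintegral _ _ _ _ hs, pow_one, pow_one, ← h a,
      lintegral_map (Kernel.measurable_coe _ hs) hg]
    refine lintegral_congr fun z => ?_
    rw [← ih z, Measure.map_apply hg hs]

theorem IsCouplingKernel.pow {E : Type*} [MeasurableSpace E] {Q : Kernel (E × E) (E × E)}
    {P : Kernel E E} (hQ : IsCouplingKernel Q P) (m : ℕ) :
    IsCouplingKernel (Q ^ m) (P ^ m) where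
  isMarkov := by
    have := hQ.isMarkov
    infer_instance
  isCoupling x y :=
    ⟨map_pow_of_map_eq measurable_fst (fun z => (hQ.isCoupling z.1 z.2).1) m (x, y),
      map_pow_of_map_eq measurable_snd (fun z => (hQ.isCoupling z.1 z.2).2) m (x, y)⟩

theorem integrable_of_lipschitzWith {E : Type*} [MetricSpace E] [MeasurableSpace E]
    [BorelSpace E] (hd : ∀ x y : E, dist x y ≤ 1) {L : ℝ≥0} {f : E → ℝ}
    (hf : LipschitzWith L f) (μ : Measure E) [IsFiniteMeasure μ] : Integrable f μ := by
  rcases isEmpty_or_nonempty E with hE | ⟨⟨x⟩⟩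
  · rw [Measure.eq_zero_of_isEmpty μ]; exact integrable_zero_measure
  refine Integrable.of_bound hf.continuous.aestronglyMeasurable (|f x| + L) (ae_of_all _ fun y => ?_)
  have h1 : |f y - f x| ≤ L := by
    rw [← Real.dist_eq]
    exact (hf.dist_le_mul y x).trans (mul_le_of_le_one_right L.2 (hd y x))
  rw [Real.norm_eq_abs]
  linarith [abs_sub_abs_le_abs_sub (f y) (f x)]

theorem tendsto_integral_dist_pow_of_rate {E : Type*} [MetricSpace E] [MeasurableSpace E]
    {Q : Kernel (E × E) (E × E)} {𝒱 : E × E → ℝ≥0} {C : ℝ}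
    (hC : ∀ m : ℕ, 2 ≤ m → ∀ x y : E,
      ∫ z, dist z.1 z.2 ∂((Q ^ m) (x, y)) ≤ C * (Real.log m / m) * 𝒱 (x, y)) (p : E × E) :
    Tendsto (fun m => ∫ z, dist z.1 z.2 ∂(Q ^ m) p) atTop (𝓝 0) := by
  have h0 : Tendsto (fun m : ℕ => Real.log m / m) atTop (𝓝 0) :=
    (Real.isLittleO_log_id_atTop.tendsto_div_nhds_zero).comp tendsto_natCast_atTop_atTop
  refine squeeze_zero' (Eventually.of_forall fun m => integral_dist_nonneg _)
    ((eventually_ge_atTop 2).mono fun m hm => hC m hm p.1 p.2) ?_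
  simpa using (h0.const_mul C).mul_const (𝒱 (p.1, p.2) : ℝ)

theorem integral_comp_of_lipschitzWith {E : Type*} [MetricSpace E] [MeasurableSpace E]
    [BorelSpace E] (hd : ∀ x y : E, dist x y ≤ 1) (P : Kernel E E)
    [IsMarkovKernel P] (μ : Measure E) [IsProbabilityMeasure μ] {L : ℝ≥0} {f : E → ℝ}
    (hf : LipschitzWith L f) : ∫ x, f x ∂(μ.bind P) = ∫ x, ∫ u, f u ∂P x ∂μ := by
  rw [Measure.comp_eq_comp_const_apply,
    Kernel.integral_comp (integrable_of_lipschitzWith hd hf _), Kernel.const_apply]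

theorem integrable_integral_of_lipschitzWith {E : Type*} [MetricSpace E] [MeasurableSpace E]
    [BorelSpace E] (hd : ∀ x y : E, dist x y ≤ 1) (P : Kernel E E)
    [IsMarkovKernel P] (μ : Measure E) [IsProbabilityMeasure μ] {L : ℝ≥0} {f : E → ℝ}
    (hf : LipschitzWith L f) : Integrable (fun x => ∫ u, f u ∂P x) μ := by
  have h : Integrable f ((P ∘ₖ Kernel.const Unit μ) ()) := integrable_of_lipschitzWith hd hf _
  exact h.integral_comp

section Lipschitz

variable {E : Type*} [MetricSpace E] [SecondCountableTopology E] [MeasurableSpace E] [BorelSpace E]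

/-- The easy half of Kantorovich duality: both integrals are taken under the common law Q(x, y),
where |f(z₁) - f(z₂)| ≤ L d(z₁, z₂). -/
theorem IsCouplingKernel.abs_integral_sub_le (hd : ∀ x y : E, dist x y ≤ 1)
    {Q : Kernel (E × E) (E × E)} {P : Kernel E E} (hQ : IsCouplingKernel Q P)
    {L : ℝ≥0} {f : E → ℝ} (hf : LipschitzWith L f) (x y : E) :
    |∫ u, f u ∂P x - ∫ u, f u ∂P y| ≤ L * ∫ z, dist z.1 z.2 ∂Q (x, y) := by
  have := hQ.isMarkov
  obtain ⟨h1, h2⟩ := hQ.isCoupling x y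
  have hi1 : Integrable (fun z : E × E => f z.1) (Q (x, y)) := by
    refine Integrable.comp_measurable ?_ measurable_fst
    exact integrable_of_lipschitzWith hd hf _
  have hi2 : Integrable (fun z : E × E => f z.2) (Q (x, y)) := by
    refine Integrable.comp_measurable ?_ measurable_snd
    exact integrable_of_lipschitzWith hd hf _
  rw [← h1, ← h2,
    integral_map measurable_fst.aemeasurable hf.continuous.aestronglyMeasurable,
    integral_map measurable_snd.aemeasurable hf.continuous.aestronglyMeasurable,
    ← integral_sub hi1 hi2, ← integral_const_mul]
  refine (abs_integral_le_integral_abs).trans (integral_mono (hi1.sub hi2).abs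
    ((integrable_dist_of_dist_le_one hd _).const_mul _) fun z => ?_)
  exact hf.dist_le_mul z.1 z.2

/-- This replaces the Feller property when passing to the weak limit in the invariance equation. -/
theorem IsCouplingKernel.lipschitzWith_integral (hd : ∀ x y : E, dist x y ≤ 1)
    {Q : Kernel (E × E) (E × E)} {P : Kernel E E} (hQ : IsCouplingKernel Q P)
    (hweak : ∀ x y : E, ∫ z, dist z.1 z.2 ∂Q (x, y) ≤ dist x y)
    {L : ℝ≥0} {f : E → ℝ} (hf : LipschitzWith L f) :
    LipschitzWith L fun x => ∫ u, f u ∂P x :=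
  LipschitzWith.of_dist_le_mul fun x y => by
    rw [Real.dist_eq]
    exact (hQ.abs_integral_sub_le hd hf x y).trans (by gcongr; exact hweak x y)

theorem measurable_integral_dist (Q : Kernel (E × E) (E × E)) :
    Measurable fun p => ∫ z, dist z.1 z.2 ∂Q p :=
  (StronglyMeasurable.integral_kernel (κ := Q) measurable_dist.stronglyMeasurable).measurable

/-- The difference between the images under `P` of a Dirac mass and of `ν`, tested against a
Lipschitz function. -/
theorem IsCouplingKernel.abs_integral_sub_integral_comp_le (hd : ∀ x y : E, dist x y ≤ 1)
    {Q : Kernel (E × E) (E × E)} {P : Kernel E E} [IsMarkovKernel P] (hQ : IsCouplingKernel Q P)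
    (x : E) (ν : Measure E) [IsProbabilityMeasure ν] {L : ℝ≥0} {f : E → ℝ}
    (hf : LipschitzWith L f) :
    |∫ u, f u ∂P x - ∫ u, f u ∂(ν.bind P)| ≤
      L * ∫ y, ∫ z, dist z.1 z.2 ∂Q (x, y) ∂ν := by
  have := hQ.isMarkov
  have hi : Integrable (fun y => ∫ u, f u ∂P y) ν :=
    integrable_integral_of_lipschitzWith hd P ν hf
  have hc : ∫ u, f u ∂P x = ∫ _, ∫ u, f u ∂P x ∂ν := by simp
  have hid : Integrable (fun y => ∫ z, dist z.1 z.2 ∂Q (x, y)) ν :=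
    Integrable.of_bound
      ((measurable_integral_dist Q).comp measurable_prodMk_left).aestronglyMeasurable 1
      (ae_of_all _ fun y => by
        rw [Real.norm_eq_abs, abs_of_nonneg (integral_dist_nonneg _)]
        exact integral_dist_le_one hd _)
  rw [integral_comp_of_lipschitzWith hd P ν hf, hc, ← integral_sub (integrable_const _) hi,
    ← integral_const_mul]
  exact (abs_integral_le_integral_abs).trans (integral_mono ((integrable_const _).sub hi).abs
    (hid.const_mul _) fun y => hQ.abs_integral_sub_le hd hf x y)

theorem tendsto_integral_integral_dist_pow (hd : ∀ x y : E, dist x y ≤ 1)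
    {Q : Kernel (E × E) (E × E)} [IsMarkovKernel Q]
    (hlim : ∀ p, Tendsto (fun m => ∫ z, dist z.1 z.2 ∂(Q ^ m) p) atTop (𝓝 0))
    {α : Type*} [MeasurableSpace α] (ρ : Measure α) [IsProbabilityMeasure ρ] {g : α → E × E}
    (hg : Measurable g) :
    Tendsto (fun m => ∫ a, ∫ z, dist z.1 z.2 ∂(Q ^ m) (g a) ∂ρ) atTop (𝓝 0) := by
  have := tendsto_integral_of_dominated_convergence (μ := ρ) (f := fun _ => (0 : ℝ))
    (F := fun m a => ∫ z, dist z.1 z.2 ∂(Q ^ m) (g a)) (fun _ => (1 : ℝ))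
    (fun m => ((measurable_integral_dist (Q ^ m)).comp hg).aestronglyMeasurable)
    (integrable_const _)
    (fun m => ae_of_all _ fun a => by
      rw [Real.norm_eq_abs, abs_of_nonneg (integral_dist_nonneg _)]
      exact integral_dist_le_one hd _)
    (ae_of_all _ fun a => hlim (g a))
  simpa using this

end Lipschitz

/-! ### Existence and uniqueness of the invariant measure -/

theorem Kernel.bind_pow_apply {α : Type*} [MeasurableSpace α] (κ : Kernel α α) (m n : ℕ) (a : α) :
    ((κ ^ n) a).bind (κ ^ m) = (κ ^ (m + n)) a := by
  rw [Kernel.pow_add, Kernel.comp_apply]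

theorem Kernel.Invariant.pow {α : Type*} [MeasurableSpace α] {κ : Kernel α α} {μ : Measure α}
    (h : Kernel.Invariant κ μ) (m : ℕ) : Kernel.Invariant (κ ^ m) μ := by
  induction m with
  | zero => rw [pow_zero]; exact Measure.bind_dirac
  | succ m ih => rw [Kernel.pow_add, pow_one]; exact ih.comp h

section Invariant

variable {E : Type*} [MetricSpace E] [SecondCountableTopology E] [MeasurableSpace E] [BorelSpace E]

/-- The rate is uniform where 𝒱(x₀, ·) ≤ R; where 𝒱(x₀, ·) ≥ R the distance is at most 1 ≤ ψ(𝒱)/A,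
so a Markov-type bound with the ψ-moment controls that part. -/
theorem exists_forall_integral_integral_dist_pow_le (hd : ∀ x y : E, dist x y ≤ 1)
    {Q : Kernel (E × E) (E × E)} [IsMarkovKernel Q] {𝒱 : E × E → ℝ≥0} {C : ℝ}
    (hC : ∀ m : ℕ, 2 ≤ m → ∀ x y : E,
      ∫ z, dist z.1 z.2 ∂((Q ^ m) (x, y)) ≤ C * (Real.log m / m) * 𝒱 (x, y))
    {ψ : ℝ≥0 → ℝ≥0} (hψ_top : Tendsto ψ atTop atTop) (x₀ : E) {ι : Type*} {ν : ι → Measure E}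
    [∀ k, IsProbabilityMeasure (ν k)]
    (hψ_bdd : ⨆ k, ∫⁻ y, (ψ (𝒱 (x₀, y)) : ℝ≥0∞) ∂(ν k) < ∞) {δ : ℝ} (hδ : 0 < δ) :
    ∃ m, ∀ k, ∫ y, ∫ z, dist z.1 z.2 ∂((Q ^ m) (x₀, y)) ∂(ν k) ≤ δ := by
  set S := (⨆ k, ∫⁻ y, (ψ (𝒱 (x₀, y)) : ℝ≥0∞) ∂(ν k)).toNNReal with hS_def
  have hS : ∀ k, ∫⁻ y, (ψ (𝒱 (x₀, y)) : ℝ≥0∞) ∂(ν k) ≤ S := fun k => by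
    rw [hS_def, ENNReal.coe_toNNReal hψ_bdd.ne]
    exact le_iSup (fun k => ∫⁻ y, (ψ (𝒱 (x₀, y)) : ℝ≥0∞) ∂(ν k)) k
  obtain ⟨δ', rfl⟩ : ∃ δ' : ℝ≥0, (δ' : ℝ) = δ := ⟨⟨δ, hδ.le⟩, rfl⟩
  have hδ' : 0 < δ' := hδ
  -- Chosen so that S / A ≤ δ'/2; the + 1 keeps A positive when S = 0.
  set A : ℝ≥0 := 2 * (S + 1) / δ' with hA_def
  have hA : 0 < A := by positivity
  have hAS : A⁻¹ * S ≤ δ' / 2 := by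
    rw [hA_def, inv_div, div_mul_eq_mul_div, div_le_div_iff₀ (by positivity) (by positivity)]
    nlinarith
  obtain ⟨R, hR⟩ := eventually_atTop.1 (hψ_top.eventually_ge_atTop A)
  have h0 : Tendsto (fun m : ℕ => |C| * (Real.log m / m) * R) atTop (𝓝 0) := by
    have h : Tendsto (fun m : ℕ => Real.log m / m) atTop (𝓝 0) :=
      (Real.isLittleO_log_id_atTop.tendsto_div_nhds_zero).comp tendsto_natCast_atTop_atTop
    simpa using (h.const_mul |C|).mul_const (R : ℝ)
  obtain ⟨m, hm, hm2⟩ := ((h0.eventually_lt_const (half_pos hδ)).and (eventually_ge_atTop 2)).exists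
  have hpt : ∀ y, ENNReal.ofReal (∫ z, dist z.1 z.2 ∂((Q ^ m) (x₀, y))) ≤
      ((δ' / 2 : ℝ≥0) : ℝ≥0∞) + (A⁻¹ : ℝ≥0) * (ψ (𝒱 (x₀, y)) : ℝ≥0∞) := by
    intro y
    rcases le_total R (𝒱 (x₀, y)) with h | h
    · refine le_trans ?_ le_add_self
      refine (ENNReal.ofReal_le_one.2 (integral_dist_le_one hd _)).trans ?_
      rw [← ENNReal.coe_mul, ENNReal.one_le_coe_iff, inv_mul_eq_div, one_le_div hA]
      exact hR _ h
    · refine le_trans ?_ le_self_add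
      rw [← ENNReal.ofReal_coe_nnreal]
      refine ENNReal.ofReal_le_ofReal ?_
      have hlog : 0 ≤ Real.log m / m := by positivity
      calc ∫ z, dist z.1 z.2 ∂((Q ^ m) (x₀, y)) ≤ C * (Real.log m / m) * 𝒱 (x₀, y) := hC m hm2 _ _
        _ ≤ |C| * (Real.log m / m) * R := by
          gcongr
          exact le_abs_self C
        _ ≤ (δ' / 2 : ℝ≥0) := by push_cast; exact hm.le
  refine ⟨m, fun k => ?_⟩
  have hmeas : Measurable fun y => ∫ z, dist z.1 z.2 ∂((Q ^ m) (x₀, y)) :=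
    (measurable_integral_dist _).comp measurable_prodMk_left
  have hint : Integrable (fun y => ∫ z, dist z.1 z.2 ∂((Q ^ m) (x₀, y))) (ν k) :=
    Integrable.of_bound hmeas.aestronglyMeasurable 1 (ae_of_all _ fun y => by
      rw [Real.norm_eq_abs, abs_of_nonneg (integral_dist_nonneg _)]
      exact integral_dist_le_one hd _)
  rw [← ENNReal.ofReal_le_ofReal_iff hδ.le,
    ofReal_integral_eq_lintegral_ofReal hint (ae_of_all _ fun y => integral_dist_nonneg _)]
  calc ∫⁻ y, ENNReal.ofReal (∫ z, dist z.1 z.2 ∂((Q ^ m) (x₀, y))) ∂(ν k)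
      ≤ ∫⁻ y, (((δ' / 2 : ℝ≥0) : ℝ≥0∞) + (A⁻¹ : ℝ≥0) * (ψ (𝒱 (x₀, y)) : ℝ≥0∞)) ∂(ν k) :=
        lintegral_mono hpt
    _ = ((δ' / 2 : ℝ≥0) : ℝ≥0∞) + (A⁻¹ : ℝ≥0) * ∫⁻ y, (ψ (𝒱 (x₀, y)) : ℝ≥0∞) ∂(ν k) := by
        -- Both rewrites avoid measurability of ψ: the constant summand is the measurable one, and
        -- the factor pulled out is finite.
        rw [lintegral_add_left measurable_const, lintegral_const_mul' _ _ ENNReal.coe_ne_top]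
        simp
    _ ≤ ((δ' / 2 : ℝ≥0) : ℝ≥0∞) + (A⁻¹ : ℝ≥0) * S := by gcongr; exact hS k
    _ ≤ ((δ' / 2 : ℝ≥0) : ℝ≥0∞) + (δ' / 2 : ℝ≥0) := by
        gcongr
        exact_mod_cast hAS
    _ = ENNReal.ofReal δ' := by
        rw [← ENNReal.coe_add, add_halves, ENNReal.ofReal_coe_nnreal]

theorem IsCouplingKernel.invariant_unique (hd : ∀ x y : E, dist x y ≤ 1)
    {Q : Kernel (E × E) (E × E)} {P : Kernel E E} [IsMarkovKernel P] (hQ : IsCouplingKernel Q P)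
    (hlim : ∀ p, Tendsto (fun m => ∫ z, dist z.1 z.2 ∂(Q ^ m) p) atTop (𝓝 0))
    {π π' : Measure E} [IsProbabilityMeasure π] [IsProbabilityMeasure π']
    (hπ : Kernel.Invariant P π) (hπ' : Kernel.Invariant P π') : π = π' := by
  have := hQ.isMarkov
  refine eq_of_forall_integral_lipschitz_eq fun L f hf => ?_
  -- By invariance both integrals can be computed after m steps; Q^m started from π × π' couples the
  -- two.
  have hbound : ∀ m, |∫ x, f x ∂π - ∫ x, f x ∂π'| ≤
      L * ∫ q, ∫ z, dist z.1 z.2 ∂(Q ^ m) q ∂(π.prod π') := by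
    intro m
    have hi := integrable_integral_of_lipschitzWith hd (P ^ m) π hf
    have hi' := integrable_integral_of_lipschitzWith hd (P ^ m) π' hf
    have e : ∫ x, f x ∂π = ∫ q, ∫ u, f u ∂(P ^ m) q.1 ∂(π.prod π') := by
      conv_lhs => rw [← (Kernel.Invariant.pow hπ m).def]
      rw [integral_comp_of_lipschitzWith hd _ _ hf, integral_fun_fst (fun x => ∫ u, f u ∂(P ^ m) x)]
      simp
    have e' : ∫ x, f x ∂π' = ∫ q, ∫ u, f u ∂(P ^ m) q.2 ∂(π.prod π') := by
      conv_lhs => rw [← (Kernel.Invariant.pow hπ' m).def]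
      rw [integral_comp_of_lipschitzWith hd _ _ hf, integral_fun_snd (fun x => ∫ u, f u ∂(P ^ m) x)]
      simp
    have hid : Integrable (fun q => ∫ z, dist z.1 z.2 ∂(Q ^ m) q) (π.prod π') :=
      Integrable.of_bound (measurable_integral_dist _).aestronglyMeasurable 1
        (ae_of_all _ fun y => by
          rw [Real.norm_eq_abs, abs_of_nonneg (integral_dist_nonneg _)]
          exact integral_dist_le_one hd _)
    rw [e, e', ← integral_sub (hi.comp_fst π') (hi'.comp_snd π), ← integral_const_mul]
    exact (abs_integral_le_integral_abs).trans (integral_mono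
      ((hi.comp_fst π').sub (hi'.comp_snd π)).abs (hid.const_mul _)
      fun q => (hQ.pow m).abs_integral_sub_le hd hf q.1 q.2)
  have hto : Tendsto (fun m => (L : ℝ) * ∫ q, ∫ z, dist z.1 z.2 ∂(Q ^ m) q ∂(π.prod π')) atTop
      (𝓝 0) := by
    simpa using (tendsto_integral_integral_dist_pow hd hlim (π.prod π') measurable_id).const_mul
      (L : ℝ)
  exact sub_eq_zero.1 (abs_eq_zero.1 (le_antisymm (ge_of_tendsto' hto hbound) (abs_nonneg _)))

/-- If the averaged distances between the chains started at `x₀` and at the points of the orbit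
of `x₀` become uniformly small along `n`, then `P` has an invariant probability measure. -/
theorem IsCouplingKernel.exists_invariant [CompleteSpace E] (hd : ∀ x y : E, dist x y ≤ 1)
    {Q : Kernel (E × E) (E × E)} {P : Kernel E E} [IsMarkovKernel P] (hQ : IsCouplingKernel Q P)
    (hweak : ∀ x y : E, ∫ z, dist z.1 z.2 ∂Q (x, y) ≤ dist x y)
    (hlim : ∀ p, Tendsto (fun m => ∫ z, dist z.1 z.2 ∂(Q ^ m) p) atTop (𝓝 0))
    (x₀ : E) {n : ℕ → ℕ} (hn : Tendsto n atTop atTop)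
    (hunif : ∀ δ : ℝ, 0 < δ →
      ∃ m, ∀ k, ∫ y, ∫ z, dist z.1 z.2 ∂((Q ^ m) (x₀, y)) ∂((P ^ n k) x₀) ≤ δ) :
    ∃ π : Measure E, IsProbabilityMeasure π ∧ Kernel.Invariant P π := by
  have := hQ.isMarkov
  have hforget : ∀ j, Tendsto (fun m => ∫ y, ∫ z, dist z.1 z.2 ∂((Q ^ m) (x₀, y)) ∂((P ^ j) x₀))
      atTop (𝓝 0) := fun j =>
    tendsto_integral_integral_dist_pow hd hlim _ measurable_prodMk_left
  -- P^(m+j)(x₀) is the law after m steps of the chain started from P^j(x₀), so Q^m couples it with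
  -- P^m(x₀).
  have hclose : ∀ (m j : ℕ) (L : ℝ≥0) (f : E → ℝ), LipschitzWith L f →
      |∫ u, f u ∂(P ^ m) x₀ - ∫ u, f u ∂(P ^ (m + j)) x₀| ≤
        L * ∫ y, ∫ z, dist z.1 z.2 ∂((Q ^ m) (x₀, y)) ∂((P ^ j) x₀) := by
    intro m j L f hf
    rw [← Kernel.bind_pow_apply]
    exact (hQ.pow m).abs_integral_sub_integral_comp_le hd x₀ _ hf
  let ν : ℕ → ProbabilityMeasure E := fun k => ⟨(P ^ n k) x₀, inferInstance⟩
  obtain ⟨π, φ, hφ, hπ⟩ := exists_tendsto_subseq_of_lipschitz_close (ν := ν) fun δ hδ => by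
    obtain ⟨m, hm⟩ := hunif (δ / 2) (half_pos hδ)
    refine ⟨(P ^ m) x₀, inferInstance, ?_⟩
    -- The intermediate law is P^(n k + m)(x₀): its distance to P^(n k)(x₀) is small for k large
    -- with m fixed, and its distance to P^m(x₀) is small for all k by the choice of m.
    filter_upwards [hn.eventually ((hforget m).eventually_le_const (half_pos hδ))] with k hk L f hf _
    have h1 := hclose (n k) m L f hf
    have h2 := hclose m (n k) L f hf
    rw [add_comm m] at h2
    rw [abs_sub_comm] at h2
    calc |∫ x, f x ∂(P ^ n k) x₀ - ∫ x, f x ∂(P ^ m) x₀|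
        ≤ |∫ x, f x ∂(P ^ n k) x₀ - ∫ x, f x ∂(P ^ (n k + m)) x₀| +
          |∫ x, f x ∂(P ^ (n k + m)) x₀ - ∫ x, f x ∂(P ^ m) x₀| := abs_sub_le _ _ _
      _ ≤ L * (δ / 2) + L * (δ / 2) := by
        refine add_le_add (h1.trans ?_) (h2.trans ?_)
        · gcongr
        · gcongr; exact hm k
      _ = L * δ := by ring
  refine ⟨π, inferInstance, ?_⟩
  rw [tendsto_iff_forall_lipschitz_integral_tendsto] at hπ
  have hbdd : ∀ (L : ℝ≥0) (f : E → ℝ), LipschitzWith L f → ∃ C : ℝ, ∀ x y, dist (f x) (f y) ≤ C :=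
    fun L f hf => ⟨L, fun x y =>
      (hf.dist_le_mul x y).trans (mul_le_of_le_one_right L.2 (hd x y))⟩
  refine eq_of_forall_integral_lipschitz_eq fun L f hf => ?_
  have hPf := hQ.lipschitzWith_integral hd hweak hf
  rw [integral_comp_of_lipschitzWith hd _ _ hf]
  have hlim1 : Tendsto (fun k => ∫ x, f x ∂(P ^ n (φ k)) x₀) atTop (𝓝 (∫ x, f x ∂(π : Measure E))) :=
    hπ f (hbdd L f hf) ⟨L, hf⟩
  have hlim2 : Tendsto (fun k => ∫ x, ∫ u, f u ∂P x ∂(P ^ n (φ k)) x₀) atTop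
      (𝓝 (∫ x, ∫ u, f u ∂P x ∂(π : Measure E))) :=
    hπ _ (hbdd L _ hPf) ⟨L, hPf⟩
  have hstep : ∀ k, ∫ x, ∫ u, f u ∂P x ∂(P ^ n (φ k)) x₀ = ∫ x, f x ∂(P ^ (n (φ k) + 1)) x₀ := by
    intro k
    rw [← integral_comp_of_lipschitzWith hd _ _ hf, add_comm, ← Kernel.bind_pow_apply, pow_one]
  -- One further step of the chain is asymptotically invisible: this is `hclose` with j = 1.
  have hdiff : Tendsto (fun k => ∫ x, f x ∂(P ^ n (φ k)) x₀ - ∫ x, ∫ u, f u ∂P x ∂(P ^ n (φ k)) x₀)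
      atTop (𝓝 0) := by
    refine squeeze_zero_norm (a := fun k => (L : ℝ) *
      ∫ y, ∫ z, dist z.1 z.2 ∂((Q ^ n (φ k)) (x₀, y)) ∂((P ^ 1) x₀)) (fun k => ?_) ?_
    · rw [hstep, Real.norm_eq_abs]
      exact hclose _ 1 L f hf
    · simpa using ((hforget 1).comp (hn.comp hφ.tendsto_atTop)).const_mul (L : ℝ)
  exact (sub_eq_zero.1 (tendsto_nhds_unique (hlim1.sub hlim2) hdiff)).symm

end Invariant

theorem mainTheorem1 {E : Type*} [MetricSpace E] [CompleteSpace E] [SecondCountableTopology E]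
    [MeasurableSpace E] [BorelSpace E]
    (hd : ∀ x y : E, dist x y ≤ 1)
    (P : Kernel E E) [IsMarkovKernel P]
    (Q : Kernel (E × E) (E × E)) (hQ : IsCouplingKernel Q P)
    (Δ : Set (E × E)) (hΔ : MeasurableSet Δ) (ℓ : ℕ) (hℓ : 1 ≤ ℓ) (ε : ℝ) (hε : 0 < ε)
    (hcontr : ContractionCondition Q Δ ℓ ε)
    (𝒱 : E × E → ℝ≥0) (h𝒱 : Measurable 𝒱) (h𝒱_one : ∀ p, 1 ≤ 𝒱 p) (b : ℝ≥0)
    (hdrift : DriftCondition Q Δ ℓ 𝒱 b)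
    (ψ : ℝ≥0 → ℝ≥0) (hψ_anti : AntitoneOn (fun v => ψ v / v) (Set.Ioi 0))
    (hψ_top : Tendsto ψ atTop atTop)
    (x₀ : E) (n : ℕ → ℕ) (hn : Tendsto n atTop atTop)
    (hψ_bdd : ⨆ k, ∫⁻ y, (ψ (𝒱 (x₀, y)) : ℝ≥0∞) ∂((P ^ n k) x₀) < ∞) :
    (∃! π : Measure E, IsProbabilityMeasure π ∧ Kernel.Invariant P π) ∧
    ∃ C : ℝ, ∀ m : ℕ, 2 ≤ m → ∀ x y : E,
      ∫ z, dist z.1 z.2 ∂((Q ^ m) (x, y)) ≤ C * (Real.log m / m) * 𝒱 (x, y) := by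
  have := hQ.isMarkov
  obtain ⟨C, hC⟩ := exists_integral_dist_pow_le hd hℓ hε hcontr h𝒱 h𝒱_one hdrift
  have hlim := tendsto_integral_dist_pow_of_rate hC
  refine ⟨?_, C, hC⟩
  obtain ⟨π, hπ, hinv⟩ := hQ.exists_invariant hd hcontr.weak hlim x₀ hn fun δ hδ =>
    exists_forall_integral_integral_dist_pow_le hd hC hψ_top x₀ hψ_bdd hδ
  refine ⟨π, ⟨hπ, hinv⟩, fun π' ⟨hπ', hinv'⟩ => ?_⟩
  exact hQ.invariant_unique hd hlim hinv' hinv
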